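/- Let $n>0$ be an even integer, and label the vertices of a regular $(n+4)$-gon $P_{n+4}$ in cyclic order by $\mathbb{Z}_{n+4}$. A triangulation of $P_{n+4}$ (with no extra vertices) is *triangle-free* if it contains no triangle whose three sides are all chords, i.e. internal edges. A chord is *short* if it joins the vertices $i-1$ and $i+1$ for some $i\in\mathbb{Z}_{n+4}$. A *proper coloring* of a triangle-free triangulation is a labeling of its chords by $0,\dots,n$, each label being used exactly once, such that the chord labeled $0$ is short and, for $0\le i<n$, the chords labeled $i$ and $i+1$ are sides of a common triangle of the triangulation. Let $CTFT(n)$ be the set of all properly colored triangle-free triangulations of $P_{n+4}$. A *flip* of a chord replaces it, as a diagonal of the quadrangle formed by the two triangles containing it, by the other diagonal of that quadrangle; the new chord receives the label of the old one and all other labels are kept. The *colored flip graph* $\Gamma_n$ has vertex set $CTFT(n)$, two colored triangulations being adjacent if one is obtained from the other by a flip of the chord labeled $i$, for some $0\le i\le n$. For $T\in CTFT(n)$ let $\psi(T)\in CTFT(n)$ be the colored triangulation obtained by rotating $T$, together with its coloring, by the angle $\pi$ about the center of $P_{n+4}$. Then $\Gamma_n$ is connected, and for every $T\in CTFT(n)$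 the distance in $\Gamma_n$ between $T$ and $\psi(T)$ is equal to the diameter $\mathrm{Diam}(\Gamma_n)$ of $\Gamma_n$. -/

import Mathlib

namespace Polygon

/-- The vertices of the convex `(n+4)`-gon, labelled in counterclockwise order by `ℤ/(n+4)`. -/
abbrev Vertex (n : ℕ) : Type := ZMod (n + 4)

/-- An unordered pair of vertices; a (nondegenerate) one is thought of as a segment. -/
abbrev Segment (n : ℕ) : Type := Sym2 (Vertex n)

/-- The external edges: the sides of the polygon. -/
def IsExternal {n : ℕ} (e : Segment n) : Prop := ∃ a : Vertex n, e = s(a, a + 1)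

/-- Chords (possible internal edges): segments between distinct vertices that are not sides. -/
def IsChord {n : ℕ} (e : Segment n) : Prop := ¬ e.IsDiag ∧ ¬ IsExternal e

/-- Short chords join `i - 1` and `i + 1`. -/
def IsShort {n : ℕ} (e : Segment n) : Prop := ∃ i : Vertex n, e = s(i - 1, i + 1)

/-- `c` lies strictly inside the counterclockwise arc from `a` to `b`. -/
def InArc {n : ℕ} (a c b : Vertex n) : Prop := 0 < (c - a).val ∧ (c - a).val < (b - a).val

/-- Two segments cross if they meet at a point interior to both: the end points of each are
strictly separated by the other. -/
def Crosses {n : ℕ} (e f : Segment n) : Prop :=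
  ∃ a b c d : Vertex n, e = s(a, b) ∧ f = s(c, d) ∧ InArc a c b ∧ InArc b d a

/-- A triangulation without extra vertices, given by its set of chords: a maximal set of
pairwise noncrossing chords. -/
def IsTriangulation {n : ℕ} (T : Set (Segment n)) : Prop :=
  (∀ e ∈ T, IsChord e) ∧ (∀ e ∈ T, ∀ f ∈ T, ¬ Crosses e f) ∧
    ∀ e, IsChord e → (∀ f ∈ T, ¬ Crosses e f) → e ∈ T

/-- `a`, `b`, `c` are the vertices of a triangle of the triangulation `T`. Its sides are internal
edges (elements of `T`) or external edges. -/
def IsTriangle {n : ℕ} (T : Set (Segment n)) (a b c : Vertex n) : Prop :=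
  a ≠ b ∧ b ≠ c ∧ a ≠ c ∧
    (s(a, b) ∈ T ∨ IsExternal s(a, b)) ∧ (s(b, c) ∈ T ∨ IsExternal s(b, c)) ∧
    (s(a, c) ∈ T ∨ IsExternal s(a, c))

/-- No triangle has three internal edges. -/
def IsTriangleFree {n : ℕ} (T : Set (Segment n)) : Prop :=
  ∀ a b c : Vertex n, IsTriangle T a b c → ¬ (s(a, b) ∈ T ∧ s(b, c) ∈ T ∧ s(a, c) ∈ T)

/-- Two segments are distinct sides of a common triangle of `T`. -/
def InCommonTriangle {n : ℕ} (T : Set (Segment n)) (e f : Segment n) : Prop :=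
  ∃ a b c : Vertex n, IsTriangle T a b c ∧ e = s(a, b) ∧ f = s(b, c)

/-- A proper coloring of `T`, given by the function sending a label `i ∈ {0, …, n}` to the chord
labelled `i`: every chord has exactly one label, the chord labelled `0` is short, and the chord
labelled `i + 1` lies in a common triangle with the chord labelled `i`. -/
def IsProperColoring {n : ℕ} (T : Set (Segment n)) (chord : Fin (n + 1) → Segment n) : Prop :=
  Set.BijOn chord Set.univ T ∧ IsShort (chord 0) ∧
    ∀ i : Fin n, InCommonTriangle T (chord i.castSucc) (chord i.succ)

/-- Triangle-free triangulations of the `(n+4)`-gon. -/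
def TFT (n : ℕ) : Type := {T : Set (Segment n) // IsTriangulation T ∧ IsTriangleFree T}

/-- Properly colored triangle-free triangulations of the `(n+4)`-gon. -/
structure CTFT (n : ℕ) where
  /-- The underlying triangle-free triangulation. -/
  T : TFT n
  /-- The chord carrying a given label. -/
  chord : Fin (n + 1) → Segment n
  /-- The labelling is a proper coloring. -/
  proper : IsProperColoring T.1 chord

/-- `e'` is the flip of the chord `e` of the triangulation `T`: the two triangles `a b c` and
`a c d` of `T` that contain `e = [a, c]` form a quadrangle, and `e' = [b, d]` is its
other diagonal. -/
def IsFlipOf {n : ℕ} (T : Set (Segment n)) (e e' : Segment n) : Prop :=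
  ∃ a b c d : Vertex n, IsTriangle T a b c ∧ IsTriangle T a c d ∧ b ≠ d ∧
    e = s(a, c) ∧ e' = s(b, d)

/-- `X'` is obtained from `X` by flipping the chord labelled `i`: the new chord replaces the old
one and takes over its label, and everything else is unchanged. -/
def FlipAt {n : ℕ} (i : Fin (n + 1)) (X X' : CTFT n) : Prop :=
  ∃ e' : Segment n, IsFlipOf X.T.1 (X.chord i) e' ∧
    X'.T.1 = insert e' (X.T.1 \ {X.chord i}) ∧ X'.chord = Function.update X.chord i e'

/-- The colored flip graph. Two distinct colored triangle-free triangulations are adjacent if one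
is obtained from the other by flipping the chord labelled `i`, for some `i`. -/
def coloredFlipGraph (n : ℕ) : SimpleGraph (CTFT n) :=
  SimpleGraph.fromRel fun X X' => ∃ i : Fin (n + 1), FlipAt i X X'

/-- The action on segments of the rotation of the polygon about its center
by the angle `2πk/(n+4)`. -/
def rotSeg {n : ℕ} (k : Vertex n) (e : Segment n) : Segment n := Sym2.map (· + k) e

section Rotation

variable {n : ℕ} (k : Vertex n)

@[simp] theorem rotSeg_mk (a b : Vertex n) : rotSeg k s(a, b) = s(a + k, b + k) := rfl

@[simp] theorem rotSeg_neg_rotSeg (e : Segment n) : rotSeg (-k) (rotSeg k e) = e := by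
  induction e using Sym2.ind with | _ a b => simp

@[simp] theorem rotSeg_rotSeg_neg (e : Segment n) : rotSeg k (rotSeg (-k) e) = e := by
  induction e using Sym2.ind with | _ a b => simp

theorem rotSeg_injective : Function.Injective (rotSeg k) :=
  Function.LeftInverse.injective (rotSeg_neg_rotSeg k)

theorem mem_rot {T : Set (Segment n)} {e : Segment n} :
    e ∈ rotSeg k '' T ↔ rotSeg (-k) e ∈ T := by
  constructor
  · rintro ⟨f, hf, rfl⟩
    simpa using hf
  · intro h
    exact ⟨_, h, by simp⟩

theorem IsExternal.rot {e : Segment n} (h : IsExternal e) : IsExternal (rotSeg k e) := by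
  obtain ⟨a, rfl⟩ := h
  exact ⟨a + k, by simp [add_right_comm]⟩

theorem isExternal_rot {e : Segment n} : IsExternal (rotSeg k e) ↔ IsExternal e :=
  ⟨fun h => by simpa using h.rot (-k), fun h => h.rot k⟩

theorem IsShort.rot {e : Segment n} (h : IsShort e) : IsShort (rotSeg k e) := by
  obtain ⟨a, rfl⟩ := h
  refine ⟨a + k, ?_⟩
  rw [rotSeg_mk, add_right_comm, sub_add_eq_add_sub]

theorem isDiag_rot {e : Segment n} : (rotSeg k e).IsDiag ↔ e.IsDiag := by
  induction e using Sym2.ind with | _ a b => simp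

theorem isChord_rot {e : Segment n} : IsChord (rotSeg k e) ↔ IsChord e := by
  simp only [IsChord, isDiag_rot, isExternal_rot]

theorem Crosses.rot {e f : Segment n} (h : Crosses e f) :
    Crosses (rotSeg k e) (rotSeg k f) := by
  obtain ⟨a, b, c, d, rfl, rfl, h1, h2⟩ := h
  exact ⟨a + k, b + k, c + k, d + k, rfl, rfl, by simpa [InArc] using h1,
    by simpa [InArc] using h2⟩

theorem IsTriangulation.rot {T : Set (Segment n)} (h : IsTriangulation T) :
    IsTriangulation (rotSeg k '' T) := by
  obtain ⟨h1, h2, h3⟩ := h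
  refine ⟨?_, ?_, ?_⟩
  · rintro _ ⟨e, he, rfl⟩
    exact (isChord_rot k).2 (h1 e he)
  · rintro _ ⟨e, he, rfl⟩ _ ⟨f, hf, rfl⟩ hc
    exact h2 e he f hf (by simpa using hc.rot (-k))
  · intro e he hc
    refine (mem_rot k).2 (h3 _ ((isChord_rot _).2 he) fun f hf hx => ?_)
    exact hc _ ⟨f, hf, rfl⟩ (by simpa using hx.rot k)

theorem IsTriangle.rot {T : Set (Segment n)} {a b c : Vertex n} (h : IsTriangle T a b c) :
    IsTriangle (rotSeg k '' T) (a + k) (b + k) (c + k) := by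
  have key : ∀ x y : Vertex n, (s(x, y) ∈ T ∨ IsExternal s(x, y)) →
      (s(x + k, y + k) ∈ rotSeg k '' T ∨ IsExternal s(x + k, y + k)) := fun x y hxy =>
    hxy.imp (fun hm => ⟨_, hm, rfl⟩) fun he => he.rot k
  obtain ⟨h1, h2, h3, h4, h5, h6⟩ := h
  exact ⟨by simpa using h1, by simpa using h2, by simpa using h3, key _ _ h4, key _ _ h5,
    key _ _ h6⟩

theorem IsTriangleFree.rot {T : Set (Segment n)} (h : IsTriangleFree T) :
    IsTriangleFree (rotSeg k '' T) := by
  intro a b c ht hm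
  have ht' := ht.rot (-k)
  have hT : rotSeg (-k) '' (rotSeg k '' T) = T := by
    rw [Set.image_image]; simp
  rw [hT] at ht'
  simp only [mem_rot, rotSeg_mk] at hm
  exact h _ _ _ ht' hm

theorem IsProperColoring.rot {T : Set (Segment n)} {chord : Fin (n + 1) → Segment n}
    (h : IsProperColoring T chord) :
    IsProperColoring (rotSeg k '' T) fun i => rotSeg k (chord i) := by
  obtain ⟨h1, h2, h3⟩ := h
  refine ⟨((rotSeg_injective k).injOn.bijOn_image).comp h1, h2.rot k, fun i => ?_⟩
  obtain ⟨a, b, c, ht, he, hf⟩ := h3 i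
  exact ⟨a + k, b + k, c + k, ht.rot k, by simp [he], by simp [hf]⟩

/-- The rotation of a colored triangle-free triangulation, with its coloring, about the center of
the polygon by the angle `2πk/(n+4)`. -/
def rotate (X : CTFT n) : CTFT n where
  T := ⟨rotSeg k '' X.T.1, X.T.2.1.rot k, X.T.2.2.rot k⟩
  chord i := rotSeg k (X.chord i)
  proper := X.proper.rot k

end Rotation

/-- The rotation by the angle `π`, that is by `(n+4)/2` steps; used for even `n`. -/
def rotatePi {n : ℕ} (X : CTFT n) : CTFT n := rotate (((n + 4) / 2 : ℕ) : Vertex n) X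

end Polygon

/-!
In a properly colored triangle-free triangulation the chord labelled `i` cuts off an arc of
`i + 2` consecutive sides, and the next chord enlarges this arc by one side, at its left or its
right end. Recording the left ends of the arcs, lifted to `ℤ`, codes colored triangulations by
integer sequences `p 0, …, p n` with steps `0` and `-1` (`IsPath`, `Codes`). Every such path codes a
colored triangulation (`IsPath.toCTFT`), every colored triangulation is coded by a path
(`exists_codes`), and the path is unique up to a multiple of the period `n + 4`
(`Codes.intCast_eq` gives the congruence of the terms).

Flips are the changes of a single term by `±1` which leave a path (`Codes.adj`,
`Codes.exists_sub_of_adj`). Any two paths `p`, `q` can be joined by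
`∑ |p i - q i|` such moves (`Codes.edist_le`). For a suitable translate of `q` by a multiple of
`n + 4` this sum is at most `(n + 1) * ((n + 4) / 2)`: the differences `p i - q i` have steps at
most `1`, so either one of them is a multiple of the period and can be translated to `0`, or all of them
lie between two consecutive multiples and one of these is close enough on average
(`exists_sum_natAbs_le`). On the other hand, rotation by `π` moves each of the `n + 1` terms by half
a period, and a flip changes the sum of the cyclic distances of the terms to those of a fixed path by
at most `1`; hence it takes at least `(n + 1) * ((n + 4) / 2)` flips (`le_edist_rotatePi`).
-/

namespace Polygon

variable {n : ℕ}

/-! ### Integer representatives of vertices -/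

theorem intCast_add_period (a : ℤ) : ((a + (n + 4) : ℤ) : Vertex n) = a := by
  have : ((n + 4 : ℕ) : ZMod (n + 4)) = 0 := ZMod.natCast_self _
  push_cast at this ⊢
  rw [this, add_zero]

theorem eq_of_intCast_eq {x y : ℤ} (h : (x : Vertex n) = y) (h1 : x - y < n + 4)
    (h2 : y - x < n + 4) : x = y := by
  rw [ZMod.intCast_eq_intCast_iff_dvd_sub] at h
  have := Int.eq_zero_of_abs_lt_dvd h (by push_cast; rw [abs_lt]; constructor <;> linarith)
  linarith

theorem intCast_ne {x y : ℤ} (h : x < y) (h' : y < x + (n + 4)) : (x : Vertex n) ≠ y := fun h0 =>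
  h.ne (eq_of_intCast_eq h0 (by omega) (by omega))

theorem exists_lift (v : Vertex n) (a : ℤ) :
    ∃ z : ℤ, a ≤ z ∧ z < a + (n + 4) ∧ (z : Vertex n) = v := by
  have h := ZMod.val_lt (v - (a : Vertex n))
  refine ⟨a + ((v - (a : Vertex n)).val : ℕ), by omega, by omega, ?_⟩
  rw [Int.cast_add, Int.cast_natCast, ZMod.natCast_zmod_val]
  ring

theorem val_intCast_sub {a c : ℤ} (h : a ≤ c) (h' : c < a + (n + 4)) :
    ((((c : Vertex n) - a).val : ℕ) : ℤ) = c - a := by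
  rw [← Int.cast_sub, ZMod.val_intCast]
  exact Int.emod_eq_of_lt (by linarith) (by push_cast; linarith)

/-- `InArc` for three integer representatives in one period starting at the first of them. -/
theorem inArc_intCast {a c b : ℤ} (hc : a ≤ c) (hc' : c < a + (n + 4)) (hb : a ≤ b)
    (hb' : b < a + (n + 4)) : InArc (a : Vertex n) c b ↔ a < c ∧ c < b := by
  have h1 := val_intCast_sub hc hc'
  have h2 := val_intCast_sub hb hb'
  unfold InArc
  omega

theorem crosses_intCast {u v w t : ℤ} (h1 : u < v) (h2 : v < w) (h3 : w < t)
    (h4 : t < u + (n + 4)) :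
    Crosses (s((u : Vertex n), (w : Vertex n))) s((v : Vertex n), (t : Vertex n)) := by
  refine ⟨u, w, v, t, rfl, rfl, ?_, ?_⟩
  · rw [inArc_intCast] <;> omega
  · rw [← intCast_add_period u, inArc_intCast] <;> omega

theorem isExternal_intCast {x y : ℤ} (h : x < y) (h' : y < x + (n + 4)) :
    IsExternal (s((x : Vertex n), (y : Vertex n))) ↔ y = x + 1 ∨ y = x + n + 3 := by
  constructor
  · rintro ⟨a, ha⟩
    rw [Sym2.eq_iff] at ha
    obtain ⟨rfl, hy⟩ | ⟨hx, rfl⟩ := ha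
    · left
      exact eq_of_intCast_eq (n := n) (by push_cast; exact hy) (by omega) (by omega)
    · right
      have : y + 1 = x + (n + 4) := eq_of_intCast_eq (n := n)
        (by rw [intCast_add_period]; push_cast; exact hx.symm) (by omega) (by omega)
      omega
  · rintro (rfl | rfl)
    · exact ⟨x, by push_cast; rfl⟩
    · refine ⟨((x + n + 3 : ℤ) : Vertex n), ?_⟩
      rw [Sym2.eq_swap]
      congr 2
      rw [← intCast_add_period x]
      push_cast
      ring

theorem isChord_intCast {x y : ℤ} (h : x + 1 < y) (h' : y < x + (n + 3)) :
    IsChord (s((x : Vertex n), (y : Vertex n))) := by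
  constructor
  · rw [Sym2.mk_isDiag_iff]
    intro h0
    have := eq_of_intCast_eq h0 (by omega) (by omega)
    omega
  · rw [isExternal_intCast] <;> omega

/-! ### Paths and the triangulations they code -/

/-- The integer sequences that code colored triangle-free triangulations: each of the first `n`
steps is `0` or `-1`. Only the terms `p 0, …, p n` matter. -/
def IsPath (n : ℕ) (p : ℕ → ℤ) : Prop := ∀ i < n, p (i + 1) = p i ∨ p (i + 1) = p i - 1

/-- The segment labelled `i` in the colored triangulation coded by `p`; it cuts off the
`i + 2` consecutive sides of the polygon between `p i` and `p i + i + 2`. -/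
def seg (n : ℕ) (p : ℕ → ℤ) (i : ℕ) : Segment n :=
  s(((p i : ℤ) : Vertex n), ((p i + i + 2 : ℤ) : Vertex n))

/-- The vertices of the polygon on the closed arc cut off by `seg n p i`. -/
def arc (n : ℕ) (p : ℕ → ℤ) (i : ℕ) : Set (Vertex n) :=
  (fun z : ℤ => (z : Vertex n)) '' Set.Icc (p i) (p i + i + 2)

theorem IsPath.le {p : ℕ → ℤ} (hp : IsPath n p) {i j : ℕ} (hij : i ≤ j) (hj : j ≤ n) :
    p j ≤ p i ∧ p i + i ≤ p j + j := by
  induction j, hij using Nat.le_induction with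
  | base => simp
  | succ j _ ih =>
    have := ih (by omega)
    rcases hp j (by omega) with h | h <;> push_cast <;> omega

theorem IsPath.arc_mono {p : ℕ → ℤ} (hp : IsPath n p) {i j : ℕ} (hij : i ≤ j) (hj : j ≤ n) :
    arc n p i ⊆ arc n p j := by
  have := hp.le hij hj
  exact Set.image_mono (Set.Icc_subset_Icc (by omega) (by omega))

theorem mem_arc_of_mem_seg {p : ℕ → ℤ} {i : ℕ} {v : Vertex n} (h : v ∈ seg n p i) :
    v ∈ arc n p i := by
  rw [seg, Sym2.mem_iff] at h
  rcases h with rfl | rfl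
  · exact ⟨_, ⟨le_rfl, by omega⟩, rfl⟩
  · exact ⟨_, ⟨by omega, le_rfl⟩, rfl⟩

/-- One end point of each chord is a new vertex, outside the arc cut off by the previous chord. -/
theorem IsPath.exists_not_mem_arc {p : ℕ → ℤ} (hp : IsPath n p) {i : ℕ} (hi : i < n) :
    ∃ v ∈ seg n p (i + 1), v ∉ arc n p i := by
  rcases hp i hi with h | h
  · refine ⟨_, Sym2.mem_mk_right _ _, ?_⟩
    rintro ⟨z, ⟨hz1, hz2⟩, hz⟩
    have := eq_of_intCast_eq hz (by push_cast; omega) (by push_cast; omega)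
    push_cast at this
    omega
  · refine ⟨_, Sym2.mem_mk_left _ _, ?_⟩
    rintro ⟨z, ⟨hz1, hz2⟩, hz⟩
    have := eq_of_intCast_eq hz (by omega) (by omega)
    omega

theorem IsPath.not_forall_mem_arc {p : ℕ → ℤ} (hp : IsPath n p) {i j : ℕ} (hij : i < j)
    (hj : j ≤ n) : ¬ ∀ v ∈ seg n p j, v ∈ arc n p i := by
  obtain ⟨k, rfl⟩ : ∃ k, j = k + 1 := ⟨j - 1, by omega⟩
  obtain ⟨v, hv, hv'⟩ := hp.exists_not_mem_arc (i := k) (by omega)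
  exact fun h => hv' (hp.arc_mono (by omega) (by omega) (h v hv))

theorem IsPath.seg_ne {p : ℕ → ℤ} (hp : IsPath n p) {i j : ℕ} (hij : i < j)
    (hj : j ≤ n) : seg n p i ≠ seg n p j := fun h =>
  hp.not_forall_mem_arc hij hj fun _ hv => mem_arc_of_mem_seg (h ▸ hv)

theorem isChord_seg (p : ℕ → ℤ) {i : ℕ} (hi : i ≤ n) : IsChord (seg n p i) :=
  isChord_intCast (by omega) (by omega)

/-- No vertex of the closed arc cut off by a chord lies strictly on the other side of it. -/
theorem not_inArc_of_mem_arc {p : ℕ → ℤ} {i : ℕ} (hi : i ≤ n) {v : Vertex n}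
    (hv : v ∈ arc n p i) : ¬ InArc ((p i + i + 2 : ℤ) : Vertex n) v (p i : ℤ) := by
  obtain ⟨z, ⟨h1, h2⟩, rfl⟩ := hv
  rw [← intCast_add_period (p i)]
  rcases h2.eq_or_lt with rfl | h2
  · simp [InArc]
  · simp only
    rw [← intCast_add_period z, inArc_intCast] <;> omega

/-- The end points of a later chord do not lie strictly inside the arc cut off by an
earlier one. -/
theorem IsPath.not_inArc_of_mem_seg {p : ℕ → ℤ} (hp : IsPath n p) {i j : ℕ} (hij : i ≤ j)
    (hj : j ≤ n) {v : Vertex n} (hv : v ∈ seg n p j) :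
    ¬ InArc ((p i : ℤ) : Vertex n) v ((p i + i + 2 : ℤ) : Vertex n) := by
  have h := hp.le hij hj
  rw [seg, Sym2.mem_iff] at hv
  rcases hv with rfl | rfl
  · rcases h.1.eq_or_lt with h0 | h0
    · simp [InArc, h0]
    · rw [← intCast_add_period (p j), inArc_intCast] <;> omega
  · rw [inArc_intCast] <;> omega

theorem IsPath.not_crosses {p : ℕ → ℤ} (hp : IsPath n p) {i j : ℕ} (hi : i ≤ n) (hj : j ≤ n) :
    ¬ Crosses (seg n p i) (seg n p j) := by
  rintro ⟨a, b, c, d, h1, h2, h3, h4⟩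
  have hc : c ∈ seg n p j := h2 ▸ Sym2.mem_mk_left _ _
  have hd : d ∈ seg n p j := h2 ▸ Sym2.mem_mk_right _ _
  rw [seg, Sym2.eq_iff] at h1
  rcases le_total i j with hij | hij
  · obtain ⟨rfl, rfl⟩ | ⟨rfl, rfl⟩ := h1
    · exact hp.not_inArc_of_mem_seg hij hj hc h3
    · exact hp.not_inArc_of_mem_seg hij hj hd h4
  · obtain ⟨rfl, rfl⟩ | ⟨rfl, rfl⟩ := h1
    · exact not_inArc_of_mem_arc hi (hp.arc_mono hij hi (mem_arc_of_mem_seg hd)) h4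
    · exact not_inArc_of_mem_arc hi (hp.arc_mono hij hi (mem_arc_of_mem_seg hc)) h3

/-- A segment from the vertex following the arc `[a, b]` into the arc that does not cross the
chord `[a, b]` ends at `a` or `b`. -/
theorem eq_or_eq_of_not_crosses_right {a b z : ℤ} (hb : b + 1 < a + (n + 4)) (h1 : a ≤ z)
    (h2 : z ≤ b)
    (h : ¬ Crosses s((z : Vertex n), ((b + 1 : ℤ) : Vertex n)) s((a : Vertex n), (b : Vertex n))) :
    z = a ∨ z = b := by
  by_contra! hz
  apply h
  rw [Sym2.eq_swap (a := (a : Vertex n)), ← intCast_add_period a]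
  exact crosses_intCast (by omega) (by omega) (by omega) (by omega)

/-- A segment from the vertex preceding the arc `[a, b]` into the arc that does not cross the
chord `[a, b]` ends at `a` or `b`. -/
theorem eq_or_eq_of_not_crosses_left {a b z : ℤ} (hb : b + 1 < a + (n + 4)) (h1 : a ≤ z)
    (h2 : z ≤ b)
    (h : ¬ Crosses s(((a - 1 : ℤ) : Vertex n), (z : Vertex n)) s((a : Vertex n), (b : Vertex n))) :
    z = a ∨ z = b := by
  by_contra! hz
  exact h (crosses_intCast (by omega) (by omega) (by omega) (by omega))

/-- A chord from the vertex added at step `i + 1` into the arc that does not cross `seg n p i`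
is `seg n p (i + 1)`. -/
theorem IsPath.eq_seg_succ {p : ℕ → ℤ} (hp : IsPath n p) {i : ℕ} (hi : i < n)
    {x y : Vertex n} (hx : x ∈ arc n p (i + 1)) (hx' : x ∉ arc n p i) (hy : y ∈ arc n p (i + 1))
    (he : IsChord s(x, y)) (hc : ¬ Crosses s(x, y) (seg n p i)) :
    s(x, y) = seg n p (i + 1) := by
  obtain ⟨u, ⟨hu1, hu2⟩, rfl⟩ := hx
  obtain ⟨v, ⟨hv1, hv2⟩, rfl⟩ := hy
  simp only at he hc ⊢
  have hu3 : u < p i ∨ p i + i + 2 < u := by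
    by_contra! h
    exact hx' ⟨u, h, rfl⟩
  have huv : u ≠ v := by
    rintro rfl
    exact he.1 (Sym2.mk_isDiag_iff.2 rfl)
  push_cast at hu2 hv2
  rcases hp i hi with h | h
  · obtain rfl : u = p i + i + 2 + 1 := by omega
    rw [Sym2.eq_swap] at he hc ⊢
    rcases eq_or_eq_of_not_crosses_right (by omega) (by omega) (by omega) hc with h1 | h1
    · rw [seg, h1, h]
      congr 2
      push_cast
      ring
    · exact absurd ((isExternal_intCast (by omega) (by omega)).2 (by omega)) he.2
  · obtain rfl : u = p i - 1 := by omega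
    rcases eq_or_eq_of_not_crosses_left (by omega) (by omega) (by omega) hc with h1 | h1
    · exact absurd ((isExternal_intCast (by omega) (by omega)).2 (by omega)) he.2
    · rw [seg, h1, h]
      congr 3
      push_cast
      ring

/-- A chord with both ends on the arc cut off by `seg n p i` which crosses none of the segments of
the path is one of them: otherwise, for minimal `i`, one of its ends is the vertex added at step
`i`, and it crosses the previous segment. -/
theorem IsPath.exists_eq_seg_of_mem_arc {p : ℕ → ℤ} (hp : IsPath n p) {i : ℕ} (hi : i ≤ n)
    {x y : Vertex n} (hx : x ∈ arc n p i) (hy : y ∈ arc n p i) (he : IsChord s(x, y))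
    (hc : ∀ j ≤ n, ¬ Crosses s(x, y) (seg n p j)) : ∃ j ≤ n, s(x, y) = seg n p j := by
  induction i generalizing x y with
  | zero =>
    obtain ⟨u, ⟨hu1, hu2⟩, rfl⟩ := hx
    obtain ⟨v, ⟨hv1, hv2⟩, rfl⟩ := hy
    simp only at he hc ⊢
    have key : ∀ u v : ℤ, p 0 ≤ u → v ≤ p 0 + 2 → u < v →
        IsChord s((u : Vertex n), (v : Vertex n)) →
        s((u : Vertex n), (v : Vertex n)) = seg n p 0 := by
      intro u v h1 h2 h3 h4
      have h5 := h4.2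
      rw [isExternal_intCast h3 (by omega)] at h5
      have : u = p 0 := by omega
      have : v = p 0 + 2 := by omega
      subst u v
      simp [seg]
    refine ⟨0, by omega, ?_⟩
    rcases lt_trichotomy u v with h | rfl | h
    · exact key u v (by omega) (by omega) h he
    · exact absurd (Sym2.mk_isDiag_iff.2 rfl) he.1
    · rw [Sym2.eq_swap] at he ⊢
      exact key v u (by omega) (by omega) h he
  | succ i ih =>
    by_cases hx' : x ∈ arc n p i
    · by_cases hy' : y ∈ arc n p i
      · exact ih (by omega) hx' hy' he hc
      · rw [Sym2.eq_swap] at he hc ⊢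
        exact ⟨i + 1, hi, hp.eq_seg_succ hi hy hy' hx he (hc i (by omega))⟩
    · exact ⟨i + 1, hi, hp.eq_seg_succ hi hx hx' hy he (hc i (by omega))⟩

theorem IsPath.exists_eq_seg {p : ℕ → ℤ} (hp : IsPath n p)
    {x y : Vertex n} (he : IsChord s(x, y))
    (hc : ∀ j ≤ n, ¬ Crosses s(x, y) (seg n p j)) : ∃ j ≤ n, s(x, y) = seg n p j := by
  -- The only vertex outside the last arc is `p n - 1`.
  have key : ∀ x y : Vertex n, IsChord s(x, y) → ¬ Crosses s(x, y) (seg n p n) →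
      x ∈ arc n p n := by
    intro x y he hc
    by_contra hx
    obtain ⟨u, hu1, hu2, rfl⟩ := exists_lift x (p n - 1)
    obtain ⟨v, hv1, hv2, rfl⟩ := exists_lift y (p n - 1)
    obtain rfl : u = p n - 1 := by
      by_contra h
      exact hx ⟨u, ⟨by omega, by omega⟩, rfl⟩
    have huv : p n - 1 ≠ v := by
      rintro rfl
      exact he.1 (Sym2.mk_isDiag_iff.2 rfl)
    have := eq_or_eq_of_not_crosses_left (by omega) (by omega) (by omega) hc
    exact he.2 ((isExternal_intCast (by omega) (by omega)).2 (by omega))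
  refine hp.exists_eq_seg_of_mem_arc le_rfl (key x y he (hc n le_rfl)) (key y x ?_ ?_) he hc
  · rwa [Sym2.eq_swap]
  · rw [Sym2.eq_swap]
    exact hc n le_rfl

/-- The segments of a path form a triangulation. -/
theorem IsPath.isTriangulation {p : ℕ → ℤ} (hp : IsPath n p) :
    IsTriangulation (Set.range fun i : Fin (n + 1) => seg n p i) := by
  refine ⟨?_, ?_, ?_⟩
  · rintro _ ⟨i, rfl⟩
    exact isChord_seg p (by omega)
  · rintro _ ⟨i, rfl⟩ _ ⟨j, rfl⟩
    exact hp.not_crosses (by omega) (by omega)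
  · intro e he hc
    induction e using Sym2.ind with | _ x y =>
    obtain ⟨j, hj, h⟩ := hp.exists_eq_seg he fun j hj => hc _ ⟨⟨j, by omega⟩, rfl⟩
    exact ⟨⟨j, by omega⟩, h.symm⟩

/-- Two sides of a triangle with smaller labels would place both ends of the third side on the
arc before the last of its ends is added. -/
theorem IsPath.not_triangle {p : ℕ → ℤ} (hp : IsPath n p) {i j k : ℕ} (hik : i < k) (hjk : j < k)
    (hk : k ≤ n) {x y z : Vertex n} (h1 : s(x, y) = seg n p i) (h2 : s(y, z) = seg n p j)
    (h3 : s(x, z) = seg n p k) : False := by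
  have hx : x ∈ arc n p (k - 1) := hp.arc_mono (by omega) (by omega)
    (mem_arc_of_mem_seg (h1 ▸ Sym2.mem_mk_left x y))
  have hz : z ∈ arc n p (k - 1) := hp.arc_mono (by omega) (by omega)
    (mem_arc_of_mem_seg (h2 ▸ Sym2.mem_mk_right y z))
  refine hp.not_forall_mem_arc (i := k - 1) (by omega) hk fun v hv => ?_
  rw [← h3, Sym2.mem_iff] at hv
  rcases hv with rfl | rfl <;> assumption

theorem IsPath.isTriangleFree {p : ℕ → ℤ} (hp : IsPath n p) :
    IsTriangleFree (Set.range fun i : Fin (n + 1) => seg n p i) := by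
  rintro x y z ⟨hxy, hyz, hxz, -⟩ ⟨⟨i, hi⟩, ⟨j, hj⟩, ⟨k, hk⟩⟩
  simp only at hi hj hk
  have hij : (i : ℕ) ≠ j := fun h => by
    rw [h, hj, Sym2.eq_iff] at hi
    grind
  have hjk : (j : ℕ) ≠ k := fun h => by
    rw [h, hk, Sym2.eq_iff] at hj
    grind
  have hik : (i : ℕ) ≠ k := fun h => by
    rw [h, hk, Sym2.eq_iff] at hi
    grind
  have h1 : ((i : ℕ) < k ∧ (j : ℕ) < k) ∨ ((i : ℕ) < j ∧ (k : ℕ) < j) ∨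
    ((j : ℕ) < i ∧ (k : ℕ) < i) := by omega
  rcases h1 with h1 | h1 | h1
  · exact hp.not_triangle h1.1 h1.2 (by omega) hi.symm hj.symm hk.symm
  · exact hp.not_triangle h1.1 h1.2 (by omega) (Sym2.eq_swap.trans hi.symm) hk.symm hj.symm
  · exact hp.not_triangle h1.2 h1.1 (by omega) hk.symm (Sym2.eq_swap.trans hj.symm) hi.symm

theorem mem_range_seg {p : ℕ → ℤ} {i : ℕ} (hi : i ≤ n) :
    seg n p i ∈ Set.range fun i : Fin (n + 1) => seg n p i :=
  ⟨⟨i, by omega⟩, rfl⟩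

theorem IsPath.isProperColoring {p : ℕ → ℤ} (hp : IsPath n p) :
    IsProperColoring (Set.range fun i : Fin (n + 1) => seg n p i)
      fun i : Fin (n + 1) => seg n p i := by
  refine ⟨⟨fun i _ => ⟨i, rfl⟩, ?_, ?_⟩, ?_, ?_⟩
  · intro i _ j _ h
    by_contra hij
    rcases lt_or_gt_of_ne hij with h' | h'
    · exact hp.seg_ne h' (by omega) h
    · exact hp.seg_ne h' (by omega) h.symm
  · rintro _ ⟨i, rfl⟩
    exact ⟨i, trivial, rfl⟩
  · refine ⟨((p 0 + 1 : ℤ) : Vertex n), ?_⟩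
    simp only [Fin.val_zero, seg]
    congr 2 <;> push_cast <;> ring
  · intro i
    have h1 := mem_range_seg (p := p) (i := i) (n := n) (by omega)
    have h2 := mem_range_seg (p := p) (i := i + 1) (n := n) (by omega)
    simp only [Fin.val_castSucc, Fin.val_succ]
    rcases hp i i.2 with h | h
    · refine ⟨(p i + i + 2 : ℤ), (p i : ℤ), (p i + i + 3 : ℤ), ?_, Sym2.eq_swap, ?_⟩
      · rw [seg, h, show p i + ((i + 1 : ℕ) : ℤ) + 2 = p i + i + 3 by push_cast; ring] at h2
        refine ⟨(intCast_ne (by omega) (by omega)).symm, intCast_ne (by omega) (by omega),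
          intCast_ne (by omega) (by omega), ?_, .inl h2, ?_⟩
        · rw [Sym2.eq_swap]
          exact .inl h1
        · exact .inr ((isExternal_intCast (by omega) (by omega)).2 (by omega))
      · rw [seg, h]
        congr 2
        push_cast
        ring
    · refine ⟨(p i : ℤ), (p i + i + 2 : ℤ), (p i - 1 : ℤ), ?_, rfl, ?_⟩
      · rw [seg, h, show p i - 1 + ((i + 1 : ℕ) : ℤ) + 2 = p i + i + 2 by push_cast; ring,
          Sym2.eq_swap] at h2
        refine ⟨intCast_ne (by omega) (by omega), (intCast_ne (by omega) (by omega)).symm,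
          (intCast_ne (by omega) (by omega)).symm, .inl h1, .inl h2, ?_⟩
        rw [Sym2.eq_swap]
        exact .inr ((isExternal_intCast (by omega) (by omega)).2 (by omega))
      · rw [seg, h, Sym2.eq_swap]
        congr 3
        push_cast
        ring

/-! ### Coding colored triangulations by paths -/

/-- The colored triangle-free triangulation coded by a path. -/
def IsPath.toCTFT {p : ℕ → ℤ} (hp : IsPath n p) : CTFT n where
  T := ⟨_, hp.isTriangulation, hp.isTriangleFree⟩
  chord i := seg n p i
  proper := hp.isProperColoring

/-- The path `p` codes the colored triangulation `X`. -/
def Codes (X : CTFT n) (p : ℕ → ℤ) : Prop := IsPath n p ∧ ∀ i : Fin (n + 1), X.chord i = seg n p i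

theorem IsPath.codes_toCTFT {p : ℕ → ℤ} (hp : IsPath n p) : Codes hp.toCTFT p :=
  ⟨hp, fun _ => rfl⟩

theorem CTFT.range_chord (X : CTFT n) : Set.range X.chord = X.T.1 := by
  rw [← Set.image_univ]
  exact X.proper.1.image_eq

theorem CTFT.ext_chord {X Y : CTFT n} (h : X.chord = Y.chord) : X = Y := by
  have hT : X.T = Y.T := Subtype.ext (by rw [← X.range_chord, ← Y.range_chord, h])
  cases X
  cases Y
  simp only at h hT
  subst h hT
  rfl

theorem Codes.eq_of_eqOn {X Y : CTFT n} {p q : ℕ → ℤ} (hX : Codes X p) (hY : Codes Y q)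
    (h : ∀ i ≤ n, p i = q i) : X = Y :=
  CTFT.ext_chord (funext fun i => by
    rw [hX.2, hY.2, seg, seg, h i (by omega)])

theorem Codes.shift {X : CTFT n} {p : ℕ → ℤ} (hX : Codes X p) (k : ℤ) :
    Codes X fun i => p i + k * (n + 4) := by
  have h0 : ((k * (n + 4) : ℤ) : Vertex n) = 0 := by
    have := intCast_add_period (n := n) 0
    rw [zero_add, Int.cast_zero] at this
    rw [Int.cast_mul, this, mul_zero]
  refine ⟨fun i hi => ?_, fun i => ?_⟩
  · rcases hX.1 i hi with h | h <;> simp only [h]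
    · simp
    · right
      ring
  · rw [hX.2, seg, seg, show p i + k * (n + 4) + i + 2 = p i + i + 2 + k * (n + 4) by ring,
      Int.cast_add (p i), h0, Int.cast_add _ (k * (n + 4)), h0, add_zero, add_zero]

theorem Codes.rotate {X : CTFT n} {p : ℕ → ℤ} (hX : Codes X p) (k : ℤ) :
    Codes (rotate (k : Vertex n) X) fun i => p i + k := by
  refine ⟨fun i hi => ?_, fun i => ?_⟩
  · rcases hX.1 i hi with h | h <;> simp only [h]
    · simp
    · right
      ring
  · change rotSeg _ (X.chord i) = _
    rw [hX.2, seg, seg, rotSeg_mk]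
    congr 2 <;> push_cast <;> ring

/-! ### Existence of a path -/

theorem CTFT.chord_mem (X : CTFT n) (i : Fin (n + 1)) : X.chord i ∈ X.T.1 :=
  X.proper.1.mapsTo (Set.mem_univ i)

theorem CTFT.chord_injective (X : CTFT n) : Function.Injective X.chord :=
  Set.injOn_univ.1 X.proper.1.injOn

/-- Consecutive chords of a properly colored triangle-free triangulation are two sides of a
triangle whose third side is a side of the polygon. -/
theorem CTFT.exists_chord_succ (X : CTFT n) (i : Fin n) :
    ∃ x y z : Vertex n, X.chord i.castSucc = s(x, y) ∧ X.chord i.succ = s(y, z) ∧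
      (z = x + 1 ∨ x = z + 1) := by
  obtain ⟨x, y, z, ht, h1, h2⟩ := X.proper.2.2 i
  refine ⟨x, y, z, h1, h2, ?_⟩
  rcases ht.2.2.2.2.2 with h | ⟨c, h⟩
  · exact absurd ⟨h1 ▸ X.chord_mem _, h2 ▸ X.chord_mem _, h⟩ (X.T.2.2 x y z ht)
  · grind [Sym2.eq_iff]

/-- The chord labelled `i + 1` is not one of the two chords that shorten the arc cut off by the
chord labelled `i`: one of them has label `i - 1`, and the other crosses that chord. -/
theorem CTFT.chord_succ_ne (X : CTFT n) {p : ℕ → ℤ} {i : ℕ} (hi : i < n)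
    (hc : ∀ j (hj : j ≤ i), X.chord ⟨j, by omega⟩ = seg n p j)
    (hs : ∀ j < i, p (j + 1) = p j ∨ p (j + 1) = p j - 1) :
    X.chord ⟨i + 1, by omega⟩ ≠ s(((p i + 1 : ℤ) : Vertex n), ((p i + i + 2 : ℤ) : Vertex n)) ∧
    X.chord ⟨i + 1, by omega⟩ ≠ s(((p i : ℤ) : Vertex n), ((p i + i + 1 : ℤ) : Vertex n)) := by
  have hch := X.T.2.1.1 _ (X.chord_mem ⟨i + 1, by omega⟩)
  rcases i with - | k
  · constructor <;> intro h <;> rw [h] at hch <;>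
      exact hch.2 ((isExternal_intCast (by push_cast; omega) (by push_cast; omega)).2
        (.inl (by push_cast; ring)))
  · have hk := hc k (by omega)
    have hne : X.chord ⟨k + 1 + 1, by omega⟩ ≠ X.chord ⟨k, by omega⟩ := fun h => by
      have := X.chord_injective h
      rw [Fin.mk.injEq] at this
      omega
    have hcr := X.T.2.1.2.1 _ (X.chord_mem ⟨k + 1 + 1, by omega⟩) _ (X.chord_mem ⟨k, by omega⟩)
    have hcr' := X.T.2.1.2.1 _ (X.chord_mem ⟨k, by omega⟩) _ (X.chord_mem ⟨k + 1 + 1, by omega⟩)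
    rw [hk, seg] at hne hcr hcr'
    rcases hs k (by omega) with h | h <;> rw [h] <;> constructor <;> intro h0
    · rw [h0] at hcr'
      exact hcr' (crosses_intCast (by omega) (by omega) (by omega) (by omega))
    · refine hne (h0.trans ?_)
      congr 2
      push_cast
      ring
    · refine hne (h0.trans ?_)
      congr 2 <;> push_cast <;> ring
    · rw [h0] at hcr
      exact hcr (crosses_intCast (by omega) (by omega) (by omega) (by omega))

theorem CTFT.exists_chord_succ_eq (X : CTFT n) {p : ℕ → ℤ} {i : ℕ} (hi : i < n)
    (hc : ∀ j (hj : j ≤ i), X.chord ⟨j, by omega⟩ = seg n p j)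
    (hs : ∀ j < i, p (j + 1) = p j ∨ p (j + 1) = p j - 1) :
    ∃ a : ℤ, (a = p i ∨ a = p i - 1) ∧
      X.chord ⟨i + 1, by omega⟩ = s((a : Vertex n), ((a + i + 3 : ℤ) : Vertex n)) := by
  obtain ⟨x, y, z, h1, h2, h3⟩ := X.exists_chord_succ ⟨i, hi⟩
  obtain ⟨hn1, hn2⟩ := X.chord_succ_ne hi hc hs
  have hci : seg n p i = s(x, y) := (hc i le_rfl).symm.trans h1
  change X.chord ⟨i + 1, by omega⟩ = _ at h2
  rw [h2] at hn1 hn2 ⊢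
  rw [seg, Sym2.eq_iff] at hci
  obtain ⟨rfl, rfl⟩ | ⟨rfl, rfl⟩ := hci
  · rcases h3 with rfl | h3
    · refine absurd ?_ hn1
      rw [Sym2.eq_swap]
      push_cast
      rfl
    · refine ⟨p i - 1, .inr rfl, ?_⟩
      rw [Sym2.eq_swap]
      congr 2
      · push_cast
        rw [h3]
        ring
      · ring
  · rcases h3 with rfl | h3
    · refine ⟨p i, .inl rfl, ?_⟩
      congr 2
      push_cast
      ring
    · refine absurd ?_ hn2
      congr 2
      push_cast at h3 ⊢
      linear_combination -h3

theorem exists_codes (X : CTFT n) : ∃ p, Codes X p := by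
  have key : ∀ i ≤ n, ∃ p : ℕ → ℤ,
      (∀ j (hj : j ≤ i) (hj' : j < n + 1), X.chord ⟨j, hj'⟩ = seg n p j) ∧
      ∀ j < i, p (j + 1) = p j ∨ p (j + 1) = p j - 1 := by
    intro i
    induction i with
    | zero =>
      intro _
      obtain ⟨v, hv⟩ := X.proper.2.1
      obtain ⟨z, -, -, rfl⟩ := exists_lift v 0
      refine ⟨fun _ => z - 1, fun j hj hj' => ?_, by omega⟩
      obtain rfl : j = 0 := by omega
      refine hv.trans ?_
      rw [seg]
      congr 2 <;> push_cast <;> ring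
    | succ i ih =>
      intro hi
      obtain ⟨p, h1, h2⟩ := ih (by omega)
      obtain ⟨a, ha, ha'⟩ := X.exists_chord_succ_eq (by omega) (fun j hj => h1 j hj _) h2
      refine ⟨Function.update p (i + 1) a, fun j hj hj' => ?_, fun j hj => ?_⟩
      · rcases hj.eq_or_lt with rfl | hj
        · rw [ha', seg, Function.update_self]
          congr 2
          push_cast
          ring
        · rw [h1 j (by omega), seg, seg, Function.update_of_ne (by omega)]
      · rw [Function.update_of_ne (a := j) (by omega)]
        rcases (Nat.lt_succ_iff.1 hj).eq_or_lt with rfl | hj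
        · rwa [Function.update_self]
        · rw [Function.update_of_ne (by omega)]
          exact h2 j hj
  obtain ⟨p, h1, h2⟩ := key n le_rfl
  exact ⟨p, h2, fun i => h1 i (by omega) _⟩

/-! ### Flips as single moves of paths -/

/-- Lowering one term of a path by one is a flip. -/
theorem Codes.flipAt {X Y : CTFT n} {p q : ℕ → ℤ} (hX : Codes X p) (hY : Codes Y q)
    (m : Fin (n + 1)) (hm : q m = p m - 1) (h : ∀ j ≤ n, j ≠ m → q j = p j) : FlipAt m X Y := by
  have hYm : Y.chord m = s(((p m + m + 1 : ℤ) : Vertex n), ((p m - 1 : ℤ) : Vertex n)) := by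
    rw [hY.2, seg, hm, Sym2.eq_swap]
    congr 2
    ring
  have hYj : ∀ j, j ≠ m → Y.chord j = X.chord j := fun j hj => by
    rw [hY.2, hX.2, seg, seg, h j (by omega) (by simpa [Fin.ext_iff] using hj)]
  have hXm : s(((p m : ℤ) : Vertex n), ((p m + m + 2 : ℤ) : Vertex n)) ∈ X.T.1 :=
    by
    have := X.chord_mem m
    rwa [hX.2] at this
  have hmn := m.is_le
  refine ⟨Y.chord m, ⟨(p m : ℤ), (p m + m + 1 : ℤ), (p m + m + 2 : ℤ), (p m - 1 : ℤ),
    ⟨intCast_ne (by omega) (by omega), intCast_ne (by omega) (by omega), intCast_ne (by omega) (by omega),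
      ?_, ?_, .inl hXm⟩,
    ⟨intCast_ne (by omega) (by omega), (intCast_ne (by omega) (by omega)).symm,
      (intCast_ne (by omega) (by omega)).symm, .inl hXm, ?_, ?_⟩,
    (intCast_ne (by omega) (by omega)).symm, hX.2 m, hYm⟩, ?_, ?_⟩
  · -- the side below the flipped chord
    obtain ⟨_ | k, hk⟩ := m
    · exact .inr ((isExternal_intCast (by push_cast; omega) (by push_cast; omega)).2
        (.inl (by push_cast; ring)))
    · left
      have hpk : p (k + 1) = p k := by
        have h1 := hX.1 k (by omega)
        have h2 := hY.1 k (by omega)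
        have h3 := h k (by omega) (by simp)
        simp only at hm
        omega
      have := X.chord_mem ⟨k, by omega⟩
      rw [hX.2, seg] at this
      simp only at this ⊢
      rw [hpk]
      convert this using 3
      push_cast
      ring
  · exact .inr ((isExternal_intCast (by omega) (by omega)).2 (by omega))
  · -- the side above the flipped chord
    rw [Sym2.eq_swap]
    rcases hmn.eq_or_lt with hmn | hmn
    · exact .inr ((isExternal_intCast (by omega) (by omega)).2 (by omega))
    · left
      have hpm : p (m + 1) = p m - 1 := by
        have h1 := hX.1 m hmn
        have h2 := hY.1 m hmn
        have h3 := h (m + 1) (by omega) (by simp)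
        omega
      have := X.chord_mem ⟨m + 1, by omega⟩
      rw [hX.2, seg] at this
      simp only at this
      rw [hpm] at this
      convert this using 3
      push_cast
      ring
  · rw [Sym2.eq_swap]
    exact .inr ((isExternal_intCast (by omega) (by omega)).2 (by omega))
  · rw [← X.range_chord, ← Y.range_chord]
    ext e
    simp only [Set.mem_range, Set.mem_insert_iff, Set.mem_sdiff, Set.mem_singleton_iff]
    constructor
    · rintro ⟨j, rfl⟩
      by_cases hj : j = m
      · exact .inl (hj ▸ rfl)
      · exact .inr ⟨⟨j, (hYj j hj).symm⟩, fun h0 =>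
          hj (X.chord_injective ((hYj j hj).symm.trans h0))⟩
    · rintro (rfl | ⟨⟨j, rfl⟩, hj⟩)
      · exact ⟨m, rfl⟩
      · exact ⟨j, hYj j fun h0 => hj (h0 ▸ rfl)⟩
  · funext j
    by_cases hj : j = m
    · subst hj
      simp
    · rw [Function.update_of_ne hj, hYj j hj]

theorem Codes.adj {X Y : CTFT n} {p q : ℕ → ℤ} (hX : Codes X p) (hY : Codes Y q)
    {m : ℕ} (hmn : m ≤ n) (hm : q m = p m - 1) (h : ∀ j ≤ n, j ≠ m → q j = p j) :
    (coloredFlipGraph n).Adj X Y := by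
  refine ⟨?_, .inl ⟨⟨m, by omega⟩, hX.flipAt hY _ hm h⟩⟩
  rintro rfl
  have := (hX.2 ⟨m, by omega⟩).symm.trans (hY.2 ⟨m, by omega⟩)
  rw [seg, seg, Sym2.eq_iff] at this
  simp only at this
  rcases this with h | h
  · have := eq_of_intCast_eq h.1 (by omega) (by omega)
    omega
  · have := eq_of_intCast_eq h.1 (by omega) (by omega)
    omega

/-! ### Uniqueness of the path modulo the period -/

theorem two_ne_zero_vertex : (2 : Vertex n) ≠ 0 := fun h => by
  have := eq_of_intCast_eq (n := n) (x := 2) (y := 0) (by exact_mod_cast h) (by omega) (by omega)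
  omega

theorem four_ne_zero_vertex (hn : 0 < n) : (4 : Vertex n) ≠ 0 := fun h => by
  have := eq_of_intCast_eq (n := n) (x := 4) (y := 0) (by exact_mod_cast h) (by omega) (by omega)
  omega

/-- A diametral segment has two descriptions of the form `[a, a + i + 2]`, but their left ends
differ by half the period, so a segment determines its left end once this is known up to one. -/
theorem intCast_eq_of_seg_eq {p q : ℕ → ℤ} {i : ℕ} (h : seg n p i = seg n q i)
    (hd : (p i : Vertex n) - q i = 0 ∨ (p i : Vertex n) - q i = 1 ∨ (p i : Vertex n) - q i = -1) :
    (p i : Vertex n) = q i := by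
  rw [seg, seg, Sym2.eq_iff] at h
  push_cast at h
  rcases h with h | ⟨h1, h2⟩
  · exact h.1
  · rcases hd with hd | hd | hd
    · linear_combination hd
    · exact absurd (by linear_combination (-2) * hd + h1 + h2) (two_ne_zero_vertex (n := n))
    · exact absurd (by linear_combination (2) * hd - h1 - h2) (two_ne_zero_vertex (n := n))

theorem IsPath.sub_succ {p q : ℕ → ℤ} (hp : IsPath n p) (hq : IsPath n q) {i : ℕ} (hi : i < n)
    (h : (p i : Vertex n) = q i) : (p (i + 1) : Vertex n) - q (i + 1) = 0 ∨
      (p (i + 1) : Vertex n) - q (i + 1) = 1 ∨ (p (i + 1) : Vertex n) - q (i + 1) = -1 := by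
  rcases hp i hi with h1 | h1 <;> rcases hq i hi with h2 | h2 <;> rw [h1, h2] <;> push_cast <;>
    rw [h] <;> ring_nf <;> simp

theorem IsPath.sub_of_succ {p q : ℕ → ℤ} (hp : IsPath n p) (hq : IsPath n q) {i : ℕ} (hi : i < n)
    (h : (p (i + 1) : Vertex n) = q (i + 1)) : (p i : Vertex n) - q i = 0 ∨
      (p i : Vertex n) - q i = 1 ∨ (p i : Vertex n) - q i = -1 := by
  rcases hp i hi with h1 | h1 <;> rcases hq i hi with h2 | h2 <;> rw [h1, h2] at h <;>
    push_cast at h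
  · left; linear_combination h
  · right; right; linear_combination h
  · right; left; linear_combination h
  · left; linear_combination h

/-- The short chord labelled `0` determines the start of the path, and thereby its terms as long
as the chords agree. -/
theorem IsPath.intCast_eq_of_lt (hn : 0 < n) {p q : ℕ → ℤ} (hp : IsPath n p) (hq : IsPath n q)
    {m : ℕ} (hm : m ≤ n + 1) (h : ∀ j < m, seg n p j = seg n q j) :
    ∀ j < m, (p j : Vertex n) = q j := by
  intro j
  induction j with
  | zero =>
    intro hj
    have h0 := h 0 hj
    rw [seg, seg, Sym2.eq_iff] at h0
    push_cast at h0
    rcases h0 with h0 | ⟨h1, h2⟩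
    · exact h0.1
    · exact absurd (by linear_combination h2 - h1) (four_ne_zero_vertex hn)
  | succ j ih =>
    intro hj
    exact intCast_eq_of_seg_eq (h _ hj) (hp.sub_succ hq (by omega) (ih (by omega)))

/-- The chord labelled `n` is short too, so that the terms are also determined from the end. -/
theorem IsPath.intCast_eq_of_gt (hn : 0 < n) {p q : ℕ → ℤ} (hp : IsPath n p) (hq : IsPath n q)
    {m : ℕ} (h : ∀ j, m < j → j ≤ n → seg n p j = seg n q j) :
    ∀ j, m < j → j ≤ n → (p j : Vertex n) = q j := by
  intro j hj hjn
  induction hjn using Nat.decreasingInduction with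
  | self =>
    have h0 := h n hj le_rfl
    have hN : (n : Vertex n) + 4 = 0 := by exact_mod_cast ZMod.natCast_self (n + 4)
    rw [seg, seg, Sym2.eq_iff] at h0
    push_cast at h0
    rcases h0 with h0 | ⟨h1, h2⟩
    · exact h0.1
    · exact absurd (by linear_combination h1 - h2 + 2 * hN) (four_ne_zero_vertex hn)
  | of_succ j hjn ih =>
    exact intCast_eq_of_seg_eq (h _ hj (by omega)) (hp.sub_of_succ hq hjn (ih (by omega)))

theorem Codes.intCast_eq (hn : 0 < n) {X : CTFT n} {p q : ℕ → ℤ} (hp : Codes X p)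
    (hq : Codes X q) {j : ℕ} (hj : j ≤ n) : (p j : Vertex n) = q j :=
  hp.1.intCast_eq_of_lt hn hq.1 le_rfl
    (fun j hj => (hp.2 ⟨j, hj⟩).symm.trans (hq.2 ⟨j, hj⟩)) j (by omega)

/-- A flip changes at most one term of the path modulo `n + 4`, and by at most one. -/
theorem Codes.exists_sub_of_adj (hn : 0 < n) {X Y : CTFT n} {p q : ℕ → ℤ} (hX : Codes X p)
    (hY : Codes Y q) (h : (coloredFlipGraph n).Adj X Y) :
    ∃ m ≤ n, (∀ j ≤ n, j ≠ m → (p j : Vertex n) = q j) ∧ ((p m : Vertex n) - q m = 0 ∨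
      (p m : Vertex n) - q m = 1 ∨ (p m : Vertex n) - q m = -1) := by
  have h1 : ∃ m : Fin (n + 1), ∀ j, j ≠ m → X.chord j = Y.chord j := by
    rcases h.2 with ⟨m, e, -, -, h⟩ | ⟨m, e, -, -, h⟩
    · exact ⟨m, fun j hj => by rw [h, Function.update_of_ne hj]⟩
    · exact ⟨m, fun j hj => by rw [h, Function.update_of_ne hj]⟩
  obtain ⟨m, hm⟩ := h1
  have hseg : ∀ j ≤ n, j ≠ m → seg n p j = seg n q j := fun j hj hjm => by
    have := hm ⟨j, by omega⟩ (by simpa [Fin.ext_iff] using hjm)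
    rwa [hX.2, hY.2] at this
  have hlt := hX.1.intCast_eq_of_lt hn hY.1 (m := m) (by omega)
    (fun j hj => hseg j (by omega) (by omega))
  have hgt := hX.1.intCast_eq_of_gt hn hY.1 (m := m)
    (fun j hj hjn => hseg j (by omega) (by omega))
  refine ⟨m, by omega, fun j hj hjm => ?_, ?_⟩
  · rcases lt_or_gt_of_ne hjm with h | h
    · exact hlt j h
    · exact hgt j h hj
  · obtain ⟨_ | k, hk⟩ := m
    · exact hX.1.sub_of_succ hY.1 hn (hgt 1 (by simp) hn)
    · exact hX.1.sub_succ hY.1 (by omega) (hlt k (by simp))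

open Finset

/-! ### The distance of two paths -/

/-- If `p` is not below `q`, some term of `p` above `q` can be lowered by one: take one at which
`2 * p i + i` is maximal, since a neighbouring step that blocks the move leads to a term with a
larger value of this function which is still above `q`. -/
theorem IsPath.exists_lower {p q : ℕ → ℤ} (hp : IsPath n p) (hq : IsPath n q)
    (h : ∃ i ≤ n, q i < p i) :
    ∃ i ≤ n, q i < p i ∧ IsPath n (Function.update p i (p i - 1)) := by
  obtain ⟨i0, hi0, hi0'⟩ := h
  obtain ⟨i, hi, hmax⟩ := Finset.exists_max_image
    ((range (n + 1)).filter fun i => q i < p i) (fun i => 2 * p i + i)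
    ⟨i0, by simp; omega⟩
  simp only [mem_filter, mem_range, and_imp] at hi hmax
  refine ⟨i, by omega, hi.2, fun j hj => ?_⟩
  by_cases h1 : j = i
  · subst h1
    rw [Function.update_self, Function.update_of_ne (by omega)]
    have := hmax (j + 1) (by omega)
    have := hq j hj
    push_cast at *
    have := hp j hj
    omega
  · rw [Function.update_of_ne h1]
    by_cases h2 : j + 1 = i
    · subst h2
      rw [Function.update_self]
      have := hmax j (by omega)
      have := hq j hj
      push_cast at *
      have := hp j hj
      omega
    · rw [Function.update_of_ne h2]
      exact hp j hj

theorem Codes.exists_adj_lower {X Y : CTFT n} {p q : ℕ → ℤ} (hX : Codes X p) (hY : Codes Y q)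
    (h : ∃ i ≤ n, q i < p i) :
    ∃ (X' : CTFT n) (p' : ℕ → ℤ), Codes X' p' ∧ (coloredFlipGraph n).Adj X X' ∧
      ∑ i ∈ range (n + 1), (p' i - q i).natAbs < ∑ i ∈ range (n + 1), (p i - q i).natAbs := by
  obtain ⟨i, hi, hlt, hp'⟩ := hX.1.exists_lower hY.1 h
  refine ⟨_, _, hp'.codes_toCTFT,
    hX.adj hp'.codes_toCTFT hi (Function.update_self ..) fun j _ hj => Function.update_of_ne hj _ _,
    Finset.sum_lt_sum (fun j _ => ?_) ⟨i, by simp; omega, ?_⟩⟩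
  · by_cases hj : j = i
    · subst hj
      rw [Function.update_self]
      omega
    · rw [Function.update_of_ne hj]
  · rw [Function.update_self]
    omega

theorem Codes.edist_le {X Y : CTFT n} {p q : ℕ → ℤ} (hX : Codes X p) (hY : Codes Y q) {d : ℕ}
    (hd : ∑ i ∈ range (n + 1), (p i - q i).natAbs ≤ d) : (coloredFlipGraph n).edist X Y ≤ d := by
  induction d generalizing X Y p q with
  | zero =>
    have h : ∀ i ≤ n, p i = q i := fun i hi => by
      have := Finset.sum_eq_zero_iff.1 (Nat.le_zero.1 hd) i (by simp; omega)
      omega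
    rw [hX.eq_of_eqOn hY h, SimpleGraph.edist_self]
    simp
  | succ d ih =>
    have step : ∀ {X Y : CTFT n} {p q : ℕ → ℤ}, Codes X p → Codes Y q →
        ∑ i ∈ range (n + 1), (p i - q i).natAbs ≤ d + 1 → (∃ i ≤ n, q i < p i) →
        (coloredFlipGraph n).edist X Y ≤ (d + 1 : ℕ) := by
      intro X Y p q hX hY hd h
      obtain ⟨X', p', hX', hadj, hlt⟩ := hX.exists_adj_lower hY h
      calc (coloredFlipGraph n).edist X Y
          ≤ (coloredFlipGraph n).edist X X' + (coloredFlipGraph n).edist X' Y :=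
            SimpleGraph.edist_triangle
        _ ≤ 1 + d := add_le_add (SimpleGraph.edist_eq_one_iff_adj.2 hadj).le
            (ih hX' hY (by omega))
        _ = (d + 1 : ℕ) := by push_cast; rw [add_comm]
    by_cases h1 : ∃ i ≤ n, q i < p i
    · exact step hX hY hd h1
    by_cases h2 : ∃ i ≤ n, p i < q i
    · rw [SimpleGraph.edist_comm]
      refine step hY hX ?_ h2
      exact (Finset.sum_congr rfl fun i _ => by omega).trans_le hd
    · push Not at h1 h2
      rw [hX.eq_of_eqOn hY fun i hi => le_antisymm (h1 i hi) (h2 i hi), SimpleGraph.edist_self]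
      simp

/-! ### The upper bound for the diameter -/

theorem sum_range_natAbs_sub_le {i : ℕ} (hi : i ≤ n) :
    2 * ∑ j ∈ range (n + 1), ((j : ℤ) - i).natAbs ≤ (n + 1) * n := by
  have h := Finset.sum_range_reflect (fun j => ((j : ℤ) - i).natAbs) (n + 1)
  calc 2 * ∑ j ∈ range (n + 1), ((j : ℤ) - i).natAbs
      = ∑ j ∈ range (n + 1), ((((n + 1 - 1 - j : ℕ) : ℤ) - i).natAbs + ((j : ℤ) - i).natAbs) := by
        rw [sum_add_distrib, h, two_mul]
    _ ≤ ∑ j ∈ range (n + 1), n := Finset.sum_le_sum fun j hj => by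
        rw [mem_range] at hj
        omega
    _ = (n + 1) * n := by simp

theorem natAbs_sub_le_of_lipschitz {d : ℕ → ℤ} (hd : ∀ i < n, (d (i + 1) - d i).natAbs ≤ 1)
    {i j : ℕ} (hij : i ≤ j) (hj : j ≤ n) : (d j - d i).natAbs ≤ j - i := by
  induction j, hij using Nat.le_induction with
  | base => simp
  | succ j _ ih =>
    have := ih (by omega)
    have := hd j (by omega)
    omega

/-- A sequence `d 0, …, d n` with steps at most `1` has, after a suitable translation by a multiple
of `2 * m`, an absolute sum of at most `(n + 1) * m`. If some term is a multiple of
`2 * m`, translate it to `0`. Otherwise all terms lie strictly between two consecutive multiples,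
and the two absolute sums for these add up to `(n + 1) * (2 * m)`. -/
theorem exists_sum_natAbs_le {m : ℕ} (hm : 0 < m) (hmn : n ≤ 2 * m) {d : ℕ → ℤ}
    (hd : ∀ i < n, (d (i + 1) - d i).natAbs ≤ 1) :
    ∃ k : ℤ, ∑ i ∈ range (n + 1), (d i - k * (2 * m)).natAbs ≤ (n + 1) * m := by
  by_cases h : ∃ i ≤ n, ∃ k : ℤ, d i = k * (2 * m)
  · obtain ⟨i, hi, k, hk⟩ := h
    refine ⟨k, ?_⟩
    have h1 := sum_range_natAbs_sub_le hi
    have h2 : ∑ j ∈ range (n + 1), (d j - k * (2 * m)).natAbs ≤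
        ∑ j ∈ range (n + 1), ((j : ℤ) - i).natAbs := Finset.sum_le_sum fun j hj => by
      rw [mem_range] at hj
      rw [← hk]
      rcases le_total i j with hij | hij
      · have := natAbs_sub_le_of_lipschitz hd hij (by omega)
        omega
      · have := natAbs_sub_le_of_lipschitz hd hij hi
        omega
    have h3 : (n + 1) * n ≤ (n + 1) * (2 * m) := Nat.mul_le_mul_left _ hmn
    rw [Nat.mul_left_comm (n + 1) 2 m] at h3
    omega
  · push Not at h
    set k := d 0 / (2 * m) with hk
    have hb : ∀ i ≤ n, k * (2 * m) < d i ∧ d i < (k + 1) * (2 * m) := by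
      intro i
      induction i with
      | zero =>
        intro _
        have h1 := h 0 (by omega) k
        have h2 := Int.ediv_mul_le (d 0) (b := 2 * m) (by omega)
        have h3 := Int.lt_ediv_add_one_mul_self (d 0) (b := 2 * m) (by omega)
        rw [← hk] at h2 h3
        exact ⟨lt_of_le_of_ne h2 h1.symm, h3⟩
      | succ i ih =>
        intro hi
        have h1 := ih (by omega)
        have h2 := hd i (by omega)
        have h3 := h (i + 1) hi k
        have h4 := h (i + 1) hi (k + 1)
        omega
    have hsum : ∑ i ∈ range (n + 1), (d i - k * (2 * m)).natAbs +
        ∑ i ∈ range (n + 1), (d i - (k + 1) * (2 * m)).natAbs = (n + 1) * (2 * m) := by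
      rw [← sum_add_distrib, Finset.sum_congr rfl (g := fun _ => 2 * m)]
      · simp
      · intro i hi
        rw [mem_range] at hi
        have := hb i (by omega)
        rw [add_mul, one_mul] at *
        omega
    rw [Nat.mul_left_comm (n + 1) 2 m] at hsum
    by_cases h1 : ∑ i ∈ range (n + 1), (d i - k * (2 * m)).natAbs ≤ (n + 1) * m
    · exact ⟨k, h1⟩
    · exact ⟨k + 1, by omega⟩

theorem edist_le_of_even (heven : Even n) (X Y : CTFT n) :
    (coloredFlipGraph n).edist X Y ≤ ((n + 1) * ((n + 4) / 2) : ℕ) := by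
  obtain ⟨p, hp⟩ := exists_codes X
  obtain ⟨q, hq⟩ := exists_codes Y
  obtain ⟨r, hr⟩ := heven
  obtain ⟨k, hk⟩ := exists_sum_natAbs_le (n := n) (m := (n + 4) / 2) (d := fun i => p i - q i)
    (by omega) (by omega) fun i hi => by
      have h1 := hp.1 i hi
      have h2 := hq.1 i hi
      omega
  refine hp.edist_le (hq.shift k) (le_of_eq_of_le (Finset.sum_congr rfl fun i _ => ?_) hk)
  have h2 : (2 * ((n + 4) / 2 : ℕ) : ℤ) = n + 4 := by omega
  rw [h2]
  congr 1
  ring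

/-! ### The lower bound for the distance to the opposite triangulation -/

/-- A path coding a given colored triangulation. -/
noncomputable def CTFT.path (X : CTFT n) : ℕ → ℤ := (exists_codes X).choose

theorem CTFT.codes_path (X : CTFT n) : Codes X X.path := (exists_codes X).choose_spec

/-- The sum of the cyclic distances, modulo `n + 4`, of the terms of the path of `X` to those
of `p`. -/
noncomputable def cyclicDist (p : ℕ → ℤ) (X : CTFT n) : ℕ :=
  ∑ i ∈ range (n + 1), ((X.path i : Vertex n) - (p i : Vertex n)).valMinAbs.natAbs

theorem natAbs_valMinAbs_le_add_one {a b : Vertex n} (h : a - b = 0 ∨ a - b = 1 ∨ a - b = -1) :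
    b.valMinAbs.natAbs ≤ a.valMinAbs.natAbs + 1 := by
  have h1 : (1 : Vertex n).valMinAbs = 1 := by
    have := ZMod.valMinAbs_natCast_of_le_half (n := n + 4) (a := 1) (by omega)
    exact_mod_cast this
  have key : ∀ c : Vertex n, c.valMinAbs.natAbs ≤ 1 → b = a + c →
      b.valMinAbs.natAbs ≤ a.valMinAbs.natAbs + 1 := by
    rintro c hc rfl
    have := ZMod.natAbs_valMinAbs_add_le a c
    omega
  rcases h with h | h | h
  · exact key 0 (by simp) (by linear_combination -h)
  · exact key (-1) (by rw [ZMod.natAbs_valMinAbs_neg, h1]; simp) (by linear_combination -h)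
  · exact key 1 (by rw [h1]; simp) (by linear_combination -h)

theorem cyclicDist_le_of_adj (hn : 0 < n) (p : ℕ → ℤ) {X Y : CTFT n}
    (h : (coloredFlipGraph n).Adj X Y) : cyclicDist p Y ≤ cyclicDist p X + 1 := by
  obtain ⟨m, hm, h1, h2⟩ := X.codes_path.exists_sub_of_adj hn Y.codes_path h
  have hm' : m ∈ range (n + 1) := by simp; omega
  unfold cyclicDist
  rw [← Finset.add_sum_erase _ _ hm', ← Finset.add_sum_erase (range (n + 1)) _ hm',
    Finset.sum_congr rfl (g := fun i => ((X.path i : Vertex n) - (p i : Vertex n)).valMinAbs.natAbs)]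
  · have := natAbs_valMinAbs_le_add_one (a := (X.path m : Vertex n) - (p m : Vertex n))
      (b := (Y.path m : Vertex n) - (p m : Vertex n)) (by rwa [sub_sub_sub_cancel_right])
    omega
  · intro i hi
    rw [mem_erase, mem_range] at hi
    rw [h1 i (by omega) hi.1]

theorem cyclicDist_le_add_length (hn : 0 < n) (p : ℕ → ℤ) {X Y : CTFT n}
    (w : (coloredFlipGraph n).Walk X Y) : cyclicDist p Y ≤ cyclicDist p X + w.length := by
  induction w with
  | nil => simp
  | cons h w ih =>
    have := cyclicDist_le_of_adj hn p h
    rw [SimpleGraph.Walk.length_cons]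
    omega

theorem le_edist_rotatePi (hn : 0 < n) (X : CTFT n) :
    (((n + 1) * ((n + 4) / 2) : ℕ) : ℕ∞) ≤ (coloredFlipGraph n).edist X (rotatePi X) := by
  have h0 : cyclicDist X.path X = 0 := by simp [cyclicDist]
  have h1 : cyclicDist X.path (rotatePi X) = (n + 1) * ((n + 4) / 2) := by
    have hc := X.codes_path.rotate ((n + 4) / 2 : ℕ)
    rw [Int.cast_natCast] at hc
    rw [cyclicDist, Finset.sum_congr rfl (g := fun _ => (n + 4) / 2)]
    · simp
    · intro i hi
      rw [mem_range] at hi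
      have := (rotatePi X).codes_path.intCast_eq hn hc (j := i) (by omega)
      rw [this, Int.cast_add, add_sub_cancel_left, Int.cast_natCast,
        ZMod.valMinAbs_natCast_of_le_half le_rfl, Int.natAbs_natCast]
  refine le_iInf fun w => ?_
  have := cyclicDist_le_add_length hn X.path w
  exact_mod_cast (by omega)

end Polygon

theorem proposition5p8 (n : ℕ) (hn : 0 < n) (heven : Even n) :
    (Polygon.coloredFlipGraph n).Connected ∧
      ∀ X : Polygon.CTFT n,
        (Polygon.coloredFlipGraph n).edist X (Polygon.rotatePi X) =
          (Polygon.coloredFlipGraph n).ediam := by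
  have hle := SimpleGraph.ediam_le_of_edist_le (Polygon.edist_le_of_even heven)
  have hpath : Polygon.IsPath n fun _ => 0 := fun _ _ => .inl rfl
  have : Nonempty (Polygon.CTFT n) := ⟨hpath.toCTFT⟩
  refine ⟨SimpleGraph.connected_of_ediam_ne_top fun h => ?_, fun X =>
    le_antisymm SimpleGraph.edist_le_ediam (hle.trans (Polygon.le_edist_rotatePi hn X))⟩
  exact absurd (h ▸ hle) (not_le.2 (ENat.natCast_lt_top _))
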